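/- Let $X$ be an infinite compact metric space and let $T\colon X\to X$ be a continuous map. Suppose that $(X,T)$ is transitive, i.e. for any two nonempty open sets $U,V\subset X$ there is $n>0$ with $T^n(U)\cap V\neq\emptyset$, and that $(X,T)$ has the shadowing property, i.e. for every $\varepsilon>0$ there is $\delta>0$ such that for every sequence $(x_n)_{n\ge 0}$ in $X$ with $d(T(x_n),x_{n+1})<\delta$ for all $n\ge 0$ there is a point $y\in X$ with $d(T^n(y),x_n)<\varepsilon$ for all $n\ge 0$. Let $M_T(X)$ be the space of $T$-invariant Borel probability measures on $X$ with the weak$^*$ topology. Then the set of non-atomic ergodic measures (those ergodic $\mu\in M_T(X)$ with $\mu(\{x\})=0$ for all $x\in X$) is residual in $M_T(X)$, i.e. its complement in $M_T(X)$ is of first category (contained in a countable union of closed nowhere dense subsets of $M_T(X)$). -/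

import Mathlib

open MeasureTheory

/-- A self-map `T` of a topological space is (topologically) transitive: for any two nonempty open
sets `U`, `V` there is `n > 0` with `T^n(U) ∩ V ≠ ∅`. -/
def IsTransitiveMap {X : Type*} [TopologicalSpace X] (T : X → X) : Prop :=
  ∀ U V : Set X, IsOpen U → IsOpen V → U.Nonempty → V.Nonempty →
    ∃ n : ℕ, 0 < n ∧ ((T^[n] '' U) ∩ V).Nonempty

/-- The sequence `x` is a `δ`-pseudo-orbit of `T`. -/
def IsPseudoOrbit {X : Type*} [MetricSpace X] (T : X → X) (δ : ℝ) (x : ℕ → X) : Prop :=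
  ∀ n : ℕ, dist (T (x n)) (x (n + 1)) < δ

/-- The shadowing property: for every `ε > 0` there is `δ > 0` such that every `δ`-pseudo-orbit
is `ε`-traced by some point. -/
def HasShadowing {X : Type*} [MetricSpace X] (T : X → X) : Prop :=
  ∀ ε : ℝ, 0 < ε → ∃ δ : ℝ, 0 < δ ∧ ∀ x : ℕ → X, IsPseudoOrbit T δ x →
    ∃ y : X, ∀ n : ℕ, dist (T^[n] y) (x n) < ε

/-- The set `M_T(X)` of `T`-invariant Borel probability measures on `X`. As a type it carries the
subspace topology of the topology of weak convergence (the weak-* topology) on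
`ProbabilityMeasure X`. -/
def invariantMeasures {X : Type*} [MeasurableSpace X] (T : X → X) :
    Set (ProbabilityMeasure X) :=
  {μ | MeasurePreserving T (μ : Measure X) (μ : Measure X)}

/-!
Both properties define countable intersections of open sets: `{μ | ∀ x, μ {x} < 1 / k}` is open,
and `μ` is ergodic as soon as, for every `f` in a dense set of continuous functions, Birkhoff
averages `A_n f` come arbitrarily `L¹(μ)`-close to constants, an open condition on `μ` for each
`f` and each precision. It remains to see that these open sets are dense.

Consider closed pseudo-orbits based at a fixed point and passing through finitely many prescribed
points. They can be concatenated, so the closure of the set of their means of a continuous map `φ`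
is convex. By transitivity an orbit segment of length `n` can be completed to such a loop by
boundedly many extra points, so this closed convex set is `O(1 / n)`-close to the values of
`A_n φ`, and hence contains `∫ φ dμ` for every invariant measure `μ`. Thus `∫ φ dμ` is approximated
by the mean over one period of a periodic pseudo-orbit visiting prescribed open sets. The points
tracing some shift of it form a closed forward invariant set, nonempty by shadowing; an invariant
measure `ν` on this set is close to `μ`, its averages `A_n f` are uniformly close to `∫ f dμ`, and
each of its atoms has mass at most `1 / m` if the orbits visit `m` disjoint open sets.
-/

open Filter Topology Set Function

open scoped ENNReal BoundedContinuousFunction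

theorem integrable_of_continuous_of_compactSpace {X E : Type*} [TopologicalSpace X]
    [CompactSpace X] [MeasurableSpace X] [OpensMeasurableSpace X] [NormedAddCommGroup E]
    {μ : Measure X} [IsFiniteMeasureOnCompacts μ] {f : X → E} (hf : Continuous f) :
    Integrable f μ :=
  hf.integrable_of_hasCompactSupport (HasCompactSupport.of_compactSpace f)

theorem continuous_integral_continuousMap {X E : Type*} [TopologicalSpace X] [CompactSpace X]
    [MeasurableSpace X] [OpensMeasurableSpace X] [NormedAddCommGroup E] [NormedSpace ℝ E]
    (μ : Measure X) [IsFiniteMeasure μ] : Continuous fun f : C(X, E) => ∫ x, f x ∂μ := by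
  refine (LipschitzWith.of_dist_le_mul (K := (μ univ).toNNReal) fun f g => ?_).continuous
  rw [dist_eq_norm, ← integral_sub (integrable_of_continuous_of_compactSpace f.continuous)
    (integrable_of_continuous_of_compactSpace g.continuous), mul_comm]
  exact norm_integral_le_of_norm_le_const <| Eventually.of_forall fun x =>
    (dist_eq_norm (f x) (g x)).symm.trans_le (ContinuousMap.dist_apply_le_dist x)

section BirkhoffAverage

variable {X E : Type*} [NormedAddCommGroup E] [NormedSpace ℝ E] {T : X → X} {f : X → E}

theorem continuous_birkhoffAverage [TopologicalSpace X] (hT : Continuous T) (hf : Continuous f)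
    (n : ℕ) : Continuous (birkhoffAverage ℝ T f n) :=
  (continuous_finsetSum _ fun i _ => hf.comp (hT.iterate i)).const_smul (n : ℝ)⁻¹

variable [MeasurableSpace X] {μ : Measure X}

theorem integrable_birkhoffAverage (hμ : MeasurePreserving T μ μ) (hf : Integrable f μ) (n : ℕ) :
    Integrable (birkhoffAverage ℝ T f n) μ :=
  (integrable_finsetSum _ fun i _ => (hμ.iterate i).integrable_comp_of_integrable hf).smul (n : ℝ)⁻¹

theorem integral_birkhoffAverage (hμ : MeasurePreserving T μ μ) (hf : Integrable f μ) {n : ℕ}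
    (hn : n ≠ 0) : ∫ x, birkhoffAverage ℝ T f n x ∂μ = ∫ x, f x ∂μ := by
  have integral_comp_iterate (i : ℕ) : ∫ x, f (T^[i] x) ∂μ = ∫ x, f x ∂μ := by
    have hi := (hμ.iterate i).map_eq
    rw [← integral_map (hμ.iterate i).aemeasurable (hi.symm ▸ hf.aestronglyMeasurable), hi]
  simp only [birkhoffAverage, birkhoffSum]
  have integrable_comp_iterate (i : ℕ) : Integrable (fun x => f (T^[i] x)) μ :=
    (hμ.iterate i).integrable_comp_of_integrable hf
  rw [integral_smul, integral_finsetSum _ fun i _ => integrable_comp_iterate i]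
  simp only [integral_comp_iterate, Finset.sum_const, Finset.card_range]
  rw [← Nat.cast_smul_eq_nsmul ℝ, inv_smul_smul₀ (Nat.cast_ne_zero.2 hn)]

theorem norm_integral_sub_measureReal_univ_smul_le [IsFiniteMeasure μ] [CompleteSpace E]
    (hμ : MeasurePreserving T μ μ) (hf : Integrable f μ) {n : ℕ} (hn : n ≠ 0) (c : E) :
    ‖∫ x, f x ∂μ - μ.real univ • c‖ ≤ ∫ x, ‖birkhoffAverage ℝ T f n x - c‖ ∂μ := by
  rw [← integral_birkhoffAverage hμ hf hn, ← integral_const,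
    ← integral_sub (integrable_birkhoffAverage hμ hf n) (integrable_const c)]
  exact norm_integral_le_integral_norm _

end BirkhoffAverage

section Ergodicity

variable {X : Type*} [MeasurableSpace X] {T : X → X} {μ : Measure X}

theorem abs_setIntegral_sub_measureReal_mul_integral_le [IsProbabilityMeasure μ]
    (hμ : MeasurePreserving T μ μ) {f : X → ℝ} (hf : Integrable f μ) {s : Set X}
    (hs : MeasurableSet s) (hTs : T ⁻¹' s = s) {n : ℕ} (hn : n ≠ 0) (c : ℝ) :
    |∫ x in s, f x ∂μ - μ.real s * ∫ x, f x ∂μ| ≤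
      2 * ∫ x, |birkhoffAverage ℝ T f n x - c| ∂μ := by
  have hμs : MeasurePreserving T (μ.restrict s) (μ.restrict s) := by
    simpa only [hTs] using hμ.restrict_preimage hs
  have on_s : |∫ x in s, f x ∂μ - μ.real s * c| ≤ ∫ x, |birkhoffAverage ℝ T f n x - c| ∂μ := by
    have h := norm_integral_sub_measureReal_univ_smul_le hμs hf.restrict hn c
    rw [measureReal_restrict_apply_univ] at h
    exact h.trans (setIntegral_le_integral
      ((integrable_birkhoffAverage hμ hf n).sub (integrable_const c)).norm
      (Eventually.of_forall fun _ => norm_nonneg _))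
  have on_univ : |∫ x, f x ∂μ - c| ≤ ∫ x, |birkhoffAverage ℝ T f n x - c| ∂μ := by
    simpa using norm_integral_sub_measureReal_univ_smul_le hμ hf hn c
  calc |∫ x in s, f x ∂μ - μ.real s * ∫ x, f x ∂μ|
      = |(∫ x in s, f x ∂μ - μ.real s * c) - μ.real s * (∫ x, f x ∂μ - c)| := by ring_nf
    _ ≤ |∫ x in s, f x ∂μ - μ.real s * c| + μ.real s * |∫ x, f x ∂μ - c| := by
        rw [← abs_of_nonneg (measureReal_nonneg (μ := μ) (s := s)), ← abs_mul,
          abs_of_nonneg measureReal_nonneg]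
        exact abs_sub _ _
    _ ≤ |∫ x in s, f x ∂μ - μ.real s * c| + |∫ x, f x ∂μ - c| := by
        gcongr
        exact mul_le_of_le_one_left (abs_nonneg _) measureReal_le_one
    _ ≤ 2 * ∫ x, |birkhoffAverage ℝ T f n x - c| ∂μ := by linarith

theorem ergodic_of_forall_restrict_eq_smul [IsProbabilityMeasure μ] (hμ : MeasurePreserving T μ μ)
    (h : ∀ s, MeasurableSet s → T ⁻¹' s = s → μ.restrict s = μ s • μ) : Ergodic T μ := by
  refine ⟨hμ, ⟨fun s hs hTs => ?_⟩⟩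
  have hself : μ s = 0 ∨ μ s = 1 := by
    refine ProbabilityTheory.measure_eq_zero_or_one_of_indepSet_self (μ := μ) (t := s) ?_
    rw [ProbabilityTheory.indepSet_iff_measure_inter_eq_mul hs hs μ,
      ← Measure.restrict_apply hs, h s hs hTs, Measure.smul_apply, smul_eq_mul]
  rw [eventuallyConst_set', ae_eq_empty, ae_eq_univ, prob_compl_eq_zero_iff hs]
  exact hself

theorem ergodic_of_dense_of_forall_birkhoffAverage [TopologicalSpace X] [CompactSpace X]
    [HasOuterApproxClosed X] [BorelSpace X] [IsProbabilityMeasure μ]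
    (hμ : MeasurePreserving T μ μ) {D : Set C(X, ℝ)} (hD : Dense D)
    (h : ∀ f ∈ D, ∀ ε : ℝ, 0 < ε →
      ∃ n : ℕ, n ≠ 0 ∧ ∃ c : ℝ, ∫ x, |birkhoffAverage ℝ T f n x - c| ∂μ < ε) :
    Ergodic T μ := by
  refine ergodic_of_forall_restrict_eq_smul hμ fun s hs hTs => ?_
  have eq_on_dense : D.EqOn (fun f => ∫ x in s, f x ∂μ) fun f => μ.real s * ∫ x, f x ∂μ := by
    intro f hf
    refine sub_eq_zero.1 (abs_nonpos_iff.1 (le_of_forall_pos_lt_add fun ε hε => ?_))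
    obtain ⟨n, hn, c, hc⟩ := h f hf (ε / 2) (half_pos hε)
    have := abs_setIntegral_sub_measureReal_mul_integral_le hμ
      (integrable_of_continuous_of_compactSpace f.continuous) hs hTs hn c
    linarith
  have integral_eq := Continuous.ext_on hD (continuous_integral_continuousMap _)
    ((continuous_integral_continuousMap μ).const_mul (μ.real s)) eq_on_dense
  have : IsFiniteMeasure (μ s • μ) := μ.smul_finite (measure_ne_top μ s)
  refine ext_of_forall_integral_eq_of_IsFiniteMeasure fun f => ?_
  rw [integral_smul_measure]
  exact congrFun integral_eq f.toContinuousMap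

end Ergodicity

section WeakTopology

variable {X : Type*} [TopologicalSpace X] [MeasurableSpace X]

theorem isOpen_setOf_measure_lt_of_isClosed [HasOuterApproxClosed X] [OpensMeasurableSpace X]
    {F : Set X} (hF : IsClosed F) (ε : ℝ≥0∞) :
    IsOpen {μ : ProbabilityMeasure X | (μ : Measure X) F < ε} :=
  isOpen_iff_mem_nhds.2 fun _ hμ => eventually_lt_of_limsup_lt <|
    (ProbabilityMeasure.limsup_measure_closed_le_of_tendsto tendsto_id hF).trans_lt hμ

theorem isOpen_setOf_exists_integral_abs_birkhoffAverage_sub_lt [CompactSpace X]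
    [OpensMeasurableSpace X] {T : X → X} (hT : Continuous T) (f : C(X, ℝ)) (ε : ℝ) :
    IsOpen {μ : ProbabilityMeasure X | ∃ n : ℕ, n ≠ 0 ∧ ∃ c : ℝ,
      ∫ x, |birkhoffAverage ℝ T f n x - c| ∂(μ : Measure X) < ε} := by
  simp only [← exists_prop, ofPred_exists]
  refine isOpen_iUnion fun n => isOpen_iUnion fun _ => isOpen_iUnion fun c => ?_
  have hA := continuous_birkhoffAverage hT f.continuous n
  exact isOpen_lt (ProbabilityMeasure.continuous_integral_continuousMap
    (⟨_, (hA.sub continuous_const).abs⟩ : C(X, ℝ))) continuous_const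

theorem dense_of_forall_finset_exists_integral_near [OpensMeasurableSpace X]
    {M : Set (ProbabilityMeasure X)} {P : ProbabilityMeasure X → Prop}
    (h : ∀ μ ∈ M, ∀ (F : Finset C(X, ℝ)) (κ : ℝ), 0 < κ → ∃ ν ∈ M, P ν ∧
      ∀ f ∈ F, |∫ x, f x ∂(ν : Measure X) - ∫ x, f x ∂(μ : Measure X)| ≤ κ) :
    Dense {μ : M | P μ} := by
  classical
  intro μ
  choose ν hνM hνP hνF using fun i : Finset C(X, ℝ) × ℕ =>
    h μ μ.2 i.1 (1 / ((i.2 : ℝ) + 1)) (by positivity)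
  refine mem_closure_of_tendsto (f := fun i => (⟨ν i, hνM i⟩ : M)) (b := atTop) ?_
    (Eventually.of_forall hνP)
  refine tendsto_subtype_rng.2 <|
    ProbabilityMeasure.tendsto_iff_forall_integral_tendsto.2 fun g => ?_
  have inv_tendsto_zero :
      Tendsto (fun i : Finset C(X, ℝ) × ℕ => 1 / ((i.2 : ℝ) + 1)) atTop (𝓝 0) :=
    tendsto_one_div_add_atTop_nhds_zero_nat.comp <| by
      rw [← prod_atTop_atTop_eq]
      exact tendsto_snd
  refine tendsto_iff_dist_tendsto_zero.2 <|
    squeeze_zero' (Eventually.of_forall fun _ => dist_nonneg) ?_ inv_tendsto_zero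
  filter_upwards [eventually_ge_atTop (({g.toContinuousMap}, 0) : Finset C(X, ℝ) × ℕ)] with i hi
  exact hνF i g.toContinuousMap (hi.1 (Finset.mem_singleton_self _))

end WeakTopology

theorem isOpen_setOf_forall_measure_singleton_lt {X : Type*} [MetricSpace X] [CompactSpace X]
    [MeasurableSpace X] [BorelSpace X] (ε : ℝ≥0∞) :
    IsOpen {μ : ProbabilityMeasure X | ∀ x : X, (μ : Measure X) {x} < ε} := by
  refine isOpen_iff_mem_nhds.2 fun μ hμ => ?_
  suffices h : ∀ x : X, ∀ᶠ p : ProbabilityMeasure X × X in 𝓝 (μ, x),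
      (p.1 : Measure X) {p.2} < ε by
    have near : ∀ᶠ ν : ProbabilityMeasure X in 𝓝 μ, ∀ x ∈ univ, (ν : Measure X) {x} < ε :=
      isCompact_univ.eventually_forall_of_forall_eventually fun x _ => h x
    filter_upwards [near] with ν hν x using hν x (mem_univ x)
  intro x
  obtain ⟨r, hr, hr0⟩ : ∃ r : ℝ, (μ : Measure X) (Metric.closedBall x r) < ε ∧ 0 < r := by
    have shrink : Tendsto (fun r => (μ : Measure X) (Metric.closedBall x r)) (𝓝[>] 0)
        (𝓝 ((μ : Measure X) {x})) := by
      refine ((tendsto_measure_cthickening_of_isClosed ⟨1, one_pos, measure_ne_top _ _⟩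
        isClosed_singleton).mono_left nhdsWithin_le_nhds).congr' ?_
      filter_upwards [self_mem_nhdsWithin] with r hr
      rw [Metric.cthickening_singleton x (le_of_lt hr)]
    exact ((shrink.eventually_lt_const (hμ x)).and self_mem_nhdsWithin).exists
  have near_μ := (isOpen_setOf_measure_lt_of_isClosed
    (Metric.isClosed_closedBall (x := x) (ε := r)) ε).mem_nhds hr
  filter_upwards [prod_mem_nhds near_μ (Metric.closedBall_mem_nhds x hr0)] with p hp
  exact (measure_mono (singleton_subset_iff.2 hp.2)).trans_lt hp.1

section KrylovBogoliubov

variable {X : Type*} [MeasurableSpace X] {T : X → X}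

/-- The uniform distribution on the first `n + 1` points of the orbit of `y` under `T`. Starting
from `n + 1` points, it is a probability measure for every `n`. -/
noncomputable def empiricalMeasure (T : X → X) (y : X) (n : ℕ) : ProbabilityMeasure X where
  val := (n + 1 : ℝ≥0∞)⁻¹ • ∑ i ∈ Finset.range (n + 1), Measure.dirac (T^[i] y)
  property := ⟨by
    simpa using ENNReal.inv_mul_cancel (a := (n : ℝ≥0∞) + 1) (by simp) (by finiteness)⟩

theorem empiricalMeasure_apply_eq_one {y : X} {Z : Set X} (hZ : MeasurableSet Z)
    (hy : ∀ i, T^[i] y ∈ Z) (n : ℕ) : (empiricalMeasure T y n : Measure X) Z = 1 := by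
  change ((n + 1 : ℝ≥0∞)⁻¹ • ∑ i ∈ Finset.range (n + 1), Measure.dirac (T^[i] y)) Z = 1
  simpa [hZ, hy] using ENNReal.inv_mul_cancel (a := (n : ℝ≥0∞) + 1) (by simp) (by finiteness)

variable [TopologicalSpace X]

theorem integral_empiricalMeasure [OpensMeasurableSpace X] (T : X → X) (y : X) (n : ℕ)
    (f : X →ᵇ ℝ) :
    ∫ x, f x ∂(empiricalMeasure T y n : Measure X) = birkhoffAverage ℝ T f (n + 1) y := by
  change ∫ x, f x ∂((n + 1 : ℝ≥0∞)⁻¹ • ∑ i ∈ Finset.range (n + 1), Measure.dirac (T^[i] y)) = _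
  rw [integral_smul_measure, integral_finsetSum_measure fun i _ => f.integrable _]
  simp [birkhoffAverage, birkhoffSum, integral_dirac', f.continuous.stronglyMeasurable,
    ENNReal.toReal_inv, ENNReal.toReal_add]

variable [HasOuterApproxClosed X] [BorelSpace X]

theorem measurePreserving_of_forall_integral_comp_eq {μ : Measure X} [IsFiniteMeasure μ]
    (hT : Continuous T) (h : ∀ f : X →ᵇ ℝ, ∫ x, f (T x) ∂μ = ∫ x, f x ∂μ) :
    MeasurePreserving T μ μ := by
  refine ⟨hT.measurable, ext_of_forall_integral_eq_of_IsFiniteMeasure fun f => ?_⟩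
  rw [integral_map hT.aemeasurable f.continuous.aestronglyMeasurable, h f]

theorem mem_invariantMeasures_of_tendsto_empiricalMeasure (hT : Continuous T) {y : X}
    {ν : ProbabilityMeasure X} {l : Filter ℕ} [l.NeBot] (hl : l ≤ atTop)
    (hν : Tendsto (empiricalMeasure T y) l (𝓝 ν)) : ν ∈ invariantMeasures T := by
  refine measurePreserving_of_forall_integral_comp_eq hT fun f => sub_eq_zero.1 ?_
  have tendsto_birkhoffAverage (g : X →ᵇ ℝ) :
      Tendsto (fun n => birkhoffAverage ℝ T g (n + 1) y) l (𝓝 (∫ x, g x ∂(ν : Measure X))) := by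
    simpa only [integral_empiricalMeasure] using
      ProbabilityMeasure.tendsto_iff_forall_integral_tendsto.1 hν g
  have diff_tendsto_zero : Tendsto (fun n => birkhoffAverage ℝ T f (n + 1) (T y) -
      birkhoffAverage ℝ T f (n + 1) y) l (𝓝 0) :=
    ((tendsto_birkhoffAverage_apply_sub_birkhoffAverage' ℝ f.isBounded_range T y).comp
      (tendsto_add_atTop_nat 1)).mono_left hl
  refine tendsto_nhds_unique (Tendsto.sub ?_ (tendsto_birkhoffAverage f)) diff_tendsto_zero
  refine (tendsto_birkhoffAverage (f.compContinuous ⟨T, hT⟩)).congr fun n => ?_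
  simp [birkhoffAverage, birkhoffSum, ← iterate_succ_apply, iterate_succ_apply']

theorem exists_mem_invariantMeasures_of_isClosed [CompactSpace X] [T2Space X] (hT : Continuous T)
    {Z : Set X} (hZ : IsClosed Z) (hne : Z.Nonempty) (hTZ : MapsTo T Z Z) :
    ∃ ν ∈ invariantMeasures T, ∀ᵐ x ∂(ν : Measure X), x ∈ Z := by
  obtain ⟨y, hy⟩ := hne
  have hu : (hyperfilter ℕ : Filter ℕ) ≤ atTop := Nat.cofinite_eq_atTop ▸ hyperfilter_le_cofinite
  obtain ⟨ν, -, hν⟩ := isCompact_univ.ultrafilter_le_nhds'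
    ((hyperfilter ℕ).map (empiricalMeasure T y)) univ_mem
  refine ⟨ν, mem_invariantMeasures_of_tendsto_empiricalMeasure hT hu hν, ?_⟩
  have hνZ : 1 ≤ (ν : Measure X) Z := by
    refine not_lt.1 ((isOpen_setOf_measure_lt_of_isClosed hZ 1).isClosed_compl.mem_of_tendsto hν
      (Eventually.of_forall fun n (hlt : (empiricalMeasure T y n : Measure X) Z < 1) => hlt.ne ?_))
    exact empiricalMeasure_apply_eq_one hZ.measurableSet (fun i => hTZ.iterate i hy) n
  exact mem_ae_iff_prob_eq_one hZ.measurableSet |>.2 (prob_le_one.antisymm hνZ)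

end KrylovBogoliubov

section ListMean

variable {X E : Type*} [NormedAddCommGroup E] [NormedSpace ℝ E] {φ : X → E}

/-- The mean of the values of `φ` at the entries of a list, counted with multiplicity; it is `0`
for the empty list. -/
noncomputable def listMean (φ : X → E) (l : List X) : E :=
  (l.length : ℝ)⁻¹ • (l.map φ).sum

theorem length_smul_listMean (φ : X → E) (l : List X) :
    (l.length : ℝ) • listMean φ l = (l.map φ).sum := by
  rcases eq_or_ne l [] with rfl | hl
  · simp
  · exact smul_inv_smul₀ (by simpa using hl) _

theorem listMean_append (φ : X → E) (l m : List X) : listMean φ (l ++ m) =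
    (l.length + m.length : ℝ)⁻¹ •
      ((l.length : ℝ) • listMean φ l + (m.length : ℝ) • listMean φ m) := by
  rw [length_smul_listMean, length_smul_listMean, listMean]
  simp

theorem listMean_perm {l m : List X} (h : l.Perm m) : listMean φ l = listMean φ m := by
  rw [listMean, listMean, h.length_eq, (h.map φ).sum_eq]

theorem listMean_map_range (φ : X → E) (z : ℕ → X) (n : ℕ) :
    listMean φ ((List.range n).map z) = (n : ℝ)⁻¹ • ∑ i ∈ Finset.range n, φ (z i) := by
  simp [listMean, Finset.sum, Multiset.range, comp_def]

theorem listMean_iterate (T : X → X) (φ : X → E) (x : X) (n : ℕ) :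
    listMean φ (List.iterate T x n) = birkhoffAverage ℝ T φ n x := by
  rw [← List.range_map_iterate, listMean_map_range, birkhoffAverage, birkhoffSum]

theorem norm_listMean_le {B : ℝ} (hφ : ∀ x, ‖φ x‖ ≤ B) (hB : 0 ≤ B) (l : List X) :
    ‖listMean φ l‖ ≤ B := by
  have norm_sum_le : ‖(l.map φ).sum‖ ≤ l.length * B := by
    induction l with
    | nil => simp
    | cons x l ih =>
      simp only [List.map_cons, List.sum_cons, List.length_cons, Nat.cast_succ]
      linarith [norm_add_le (φ x) (l.map φ).sum, hφ x]
  rw [listMean, norm_smul, norm_inv, Real.norm_natCast]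
  exact inv_mul_le_of_le_mul₀ (Nat.cast_nonneg _) hB norm_sum_le

theorem dist_listMean_append_le {B : ℝ} (hφ : ∀ x, ‖φ x‖ ≤ B) (hB : 0 ≤ B) (l : List X)
    {m : List X} (hm : m ≠ []) :
    dist (listMean φ m) (listMean φ (l ++ m)) ≤ 2 * B * l.length / m.length := by
  have hm0 : (0 : ℝ) < m.length := by simpa [List.length_pos_iff] using hm
  have difference : listMean φ m - listMean φ (l ++ m) =
      (l.length / (l.length + m.length) : ℝ) • (listMean φ m - listMean φ l) := by
    rw [listMean_append]
    match_scalars <;> field_simp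
    ring
  rw [dist_eq_norm, difference, norm_smul, Real.norm_of_nonneg (by positivity)]
  calc (l.length / (l.length + m.length) : ℝ) * ‖listMean φ m - listMean φ l‖
      ≤ (l.length / m.length : ℝ) * (B + B) := by
        gcongr
        · simp
        · exact norm_sub_le_of_le (norm_listMean_le hφ hB m) (norm_listMean_le hφ hB l)
    _ = 2 * B * l.length / m.length := by ring

theorem listMean_append_flatten_replicate {l m : List X} (hl : l ≠ []) (hm : m ≠ []) (j k : ℕ) :
    listMean φ ((List.replicate (j * m.length) l).flatten ++
        (List.replicate (k * l.length) m).flatten) =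
      (j + k : ℝ)⁻¹ • ((j : ℝ) • listMean φ l + (k : ℝ) • listMean φ m) := by
  have hl0 : (l.length : ℝ) ≠ 0 := by simpa using hl
  have hm0 : (m.length : ℝ) ≠ 0 := by simpa using hm
  rw [listMean]
  simp only [List.length_append, List.length_flatten, List.map_append, List.map_flatten,
    List.map_replicate, List.sum_append, List.sum_flatten, List.sum_replicate,
    ← length_smul_listMean, ← Nat.cast_smul_eq_nsmul ℝ, smul_eq_mul, Nat.cast_add, Nat.cast_mul]
  match_scalars <;> field_simp

theorem flatten_replicate_mem {S : Set (List X)} (hS : ∀ l ∈ S, ∀ m ∈ S, l ++ m ∈ S)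
    {l : List X} (hl : l ∈ S) {k : ℕ} (hk : k ≠ 0) : (List.replicate k l).flatten ∈ S := by
  induction k, Nat.one_le_iff_ne_zero.2 hk using Nat.le_induction with
  | base => simpa using hl
  | succ k hk ih => exact hS l hl _ (ih (by omega))

theorem tendsto_ceil_mul_div_add_ceil_mul {a b : ℝ} (ha : 0 < a) (hb : 0 < b) (hab : a + b = 1) :
    Tendsto (fun k : ℕ => (⌈a * k⌉₊ / (⌈a * k⌉₊ + ⌈b * k⌉₊) : ℝ)) atTop (𝓝 a) := by
  have tendsto_div (c : ℝ) (hc : 0 < c) :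
      Tendsto (fun k : ℕ => (⌈c * k⌉₊ / k : ℝ)) atTop (𝓝 c) :=
    (tendsto_nat_ceil_mul_div_atTop hc.le).comp tendsto_natCast_atTop_atTop
  have h := (tendsto_div a ha).div ((tendsto_div a ha).add (tendsto_div b hb)) (by simp [hab])
  rw [hab, div_one] at h
  refine h.congr' ?_
  filter_upwards [eventually_ne_atTop 0] with k hk
  have : (k : ℝ) ≠ 0 := Nat.cast_ne_zero.2 hk
  rw [Pi.div_apply, ← add_div, div_div_div_cancel_right₀ this]

theorem convex_closure_image_listMean {S : Set (List X)} (hnil : [] ∉ S)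
    (happend : ∀ l ∈ S, ∀ m ∈ S, l ++ m ∈ S) : Convex ℝ (closure (listMean φ '' S)) := by
  refine convex_iff_forall_pos.2 fun v hv w hw a b ha hb hab => ?_
  rw [← closure_closure]
  refine map_mem_closure₂ (f := fun v w : E => a • v + b • w) (by fun_prop) hv hw ?_
  rintro _ ⟨l, hl, rfl⟩ _ ⟨m, hm, rfl⟩
  have tendsto_means : Tendsto (fun k : ℕ => (⌈a * k⌉₊ + ⌈b * k⌉₊ : ℝ)⁻¹ •
      ((⌈a * k⌉₊ : ℝ) • listMean φ l + (⌈b * k⌉₊ : ℝ) • listMean φ m)) atTop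
      (𝓝 (a • listMean φ l + b • listMean φ m)) := by
    refine (((tendsto_ceil_mul_div_add_ceil_mul ha hb hab).smul_const (listMean φ l)).add
      ((tendsto_ceil_mul_div_add_ceil_mul hb ha (by linarith)).smul_const
        (listMean φ m))).congr fun k => ?_
    match_scalars <;> ring
  refine mem_closure_of_tendsto tendsto_means ?_
  filter_upwards [eventually_gt_atTop 0] with k hk
  have hl' := ne_of_mem_of_not_mem hl hnil
  have hm' := ne_of_mem_of_not_mem hm hnil
  have hl0 := List.length_pos_iff.2 hl'
  have hm0 := List.length_pos_iff.2 hm'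
  rw [← listMean_append_flatten_replicate hl' hm']
  exact mem_image_of_mem _ <| happend _ (flatten_replicate_mem happend hl (by positivity)) _
    (flatten_replicate_mem happend hm (by positivity))

end ListMean

/-- `IsPseudoChain T δ u l v` says that `l ++ [v]` is a finite `δ`-pseudo-orbit of `T` which starts
at `u`. The endpoint `v` is not an entry of `l`, so that composable chains are concatenated by
appending their lists. -/
inductive IsPseudoChain {X : Type*} [PseudoMetricSpace X] (T : X → X) (δ : ℝ) :
    X → List X → X → Prop
  | nil (u : X) : IsPseudoChain T δ u [] u
  | cons {u v w : X} {l : List X} (h : dist (T u) w < δ) (hl : IsPseudoChain T δ w l v) :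
      IsPseudoChain T δ u (u :: l) v

namespace IsPseudoChain

variable {X : Type*} [PseudoMetricSpace X] {T : X → X} {δ : ℝ} {u v w : X} {l m : List X}

theorem append (hl : IsPseudoChain T δ u l v) (hm : IsPseudoChain T δ v m w) :
    IsPseudoChain T δ u (l ++ m) w := by
  induction hl with
  | nil u => exact hm
  | cons h _ ih => exact cons h (ih hm)

theorem iterate_of_dist_lt {n : ℕ} (h : dist (T^[n + 1] u) v < δ) :
    IsPseudoChain T δ u (List.iterate T u (n + 1)) v := by
  induction n generalizing u with
  | zero => exact cons h (nil v)
  | succ n ih => exact cons (by simpa using dist_nonneg.trans_lt h) (ih h)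

theorem getElem_zero (h : IsPseudoChain T δ u l v) : (l ++ [v])[0]'(by simp) = u := by
  cases h <;> rfl

theorem dist_getElem_succ_lt (h : IsPseudoChain T δ u l v) {i : ℕ} (hi : i < l.length) :
    dist (T l[i]) ((l ++ [v])[i + 1]'(by simpa using hi)) < δ := by
  induction h generalizing i with
  | nil => simp at hi
  | cons h hl ih =>
    cases i with
    | zero => simpa [hl.getElem_zero] using h
    | succ i => simpa using ih (by simpa using hi)

end IsPseudoChain

theorem exists_periodic_isPseudoOrbit {X : Type*} [MetricSpace X] {T : X → X} {δ : ℝ} {u : X}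
    {l : List X} (hl : l ≠ []) (h : IsPseudoChain T δ u l u) :
    ∃ z : ℕ → X, Periodic z l.length ∧ IsPseudoOrbit T δ z ∧ (List.range l.length).map z = l := by
  have hpos : 0 < l.length := List.length_pos_iff.2 hl
  refine ⟨fun i => l[i % l.length]'(Nat.mod_lt i hpos), fun i => by simp, fun i => ?_,
    List.ext_getElem (by simp) fun i _ hi => by simp [Nat.mod_eq_of_lt hi]⟩
  have hi : i % l.length < l.length := Nat.mod_lt i hpos
  have step := h.dist_getElem_succ_lt hi
  suffices wrap : (l ++ [u])[i % l.length + 1]'(by simpa using hi) =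
      l[(i + 1) % l.length]'(Nat.mod_lt _ hpos) by rwa [wrap] at step
  rcases Nat.lt_or_eq_of_le (show i % l.length + 1 ≤ l.length from hi) with hlt | heq
  · have next : (i + 1) % l.length = i % l.length + 1 := by
      rw [← Nat.mod_add_mod, Nat.mod_eq_of_lt hlt]
    simp only [next, List.getElem_append_left hlt]
  · have next : (i + 1) % l.length = 0 := by
      rw [← Nat.mod_add_mod, heq, Nat.mod_self]
    have head_eq : l[0] = u := by
      simpa only [List.getElem_append_left hpos] using h.getElem_zero
    simp only [next, head_eq, List.getElem_concat_length heq]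

section TransitiveChains

variable {X : Type*} [PseudoMetricSpace X] {T : X → X} {δ : ℝ}

theorem exists_dist_lt_of_isTransitiveMap (htrans : IsTransitiveMap T) (hδ : 0 < δ) (u v : X) :
    ∃ (n : ℕ) (w : X), dist (T u) w < δ ∧ dist (T^[n + 1] w) v < δ := by
  obtain ⟨n, hn, -, ⟨w, hw, rfl⟩, hv⟩ := htrans (Metric.ball (T u) δ) (Metric.ball v δ)
    Metric.isOpen_ball Metric.isOpen_ball ⟨_, Metric.mem_ball_self hδ⟩ ⟨_, Metric.mem_ball_self hδ⟩
  obtain ⟨n, rfl⟩ := Nat.exists_eq_succ_of_ne_zero hn.ne'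
  exact ⟨n, w, Metric.mem_ball'.1 hw, hv⟩

/-- The nonempty closed `δ`-pseudo-chains of `T` based at `u` which pass through every point
of `A`. -/
def pseudoLoops (T : X → X) (δ : ℝ) (u : X) (A : Finset X) : Set (List X) :=
  {l | l ≠ [] ∧ IsPseudoChain T δ u l u ∧ ∀ a ∈ A, a ∈ l}

theorem append_mem_pseudoLoops {u : X} {A : Finset X} {l m : List X}
    (hl : l ∈ pseudoLoops T δ u A) (hm : m ∈ pseudoLoops T δ u A) :
    l ++ m ∈ pseudoLoops T δ u A :=
  ⟨by simp [hl.1], hl.2.1.append hm.2.1, fun a ha => List.mem_append_left m (hl.2.2 a ha)⟩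

variable [CompactSpace X]

theorem exists_isPseudoChain_length_le (hT : Continuous T) (htrans : IsTransitiveMap T)
    (hδ : 0 < δ) : ∃ L : ℕ, ∀ u v : X, ∃ l, l ≠ [] ∧ l.length ≤ L ∧ IsPseudoChain T δ u l v := by
  let joined (n : ℕ) : Set (X × X) := ⋃ w, {p | dist (T p.1) w < δ ∧ dist (T^[n + 1] w) p.2 < δ}
  have isOpen_joined (n : ℕ) : IsOpen (joined n) := isOpen_iUnion fun w =>
    (isOpen_lt (f := fun p : X × X => dist (T p.1) w) (by fun_prop) continuous_const).inter
      (isOpen_lt (f := fun p : X × X => dist (T^[n + 1] w) p.2) (by fun_prop) continuous_const)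
  obtain ⟨t, ht⟩ := isCompact_univ.elim_finite_subcover joined isOpen_joined fun p _ => by
    simpa [joined] using exists_dist_lt_of_isTransitiveMap htrans hδ p.1 p.2
  refine ⟨t.sup id + 2, fun u v => ?_⟩
  obtain ⟨n, hnt, hn⟩ := mem_iUnion₂.1 (ht (mem_univ (u, v)))
  obtain ⟨w, huw, hwv⟩ := mem_iUnion.1 hn
  exact ⟨_, List.cons_ne_nil _ _, by simpa using Finset.le_sup (f := id) hnt,
    .cons huw (.iterate_of_dist_lt hwv)⟩

theorem pseudoLoops_nonempty (hT : Continuous T) (htrans : IsTransitiveMap T) (hδ : 0 < δ)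
    (u : X) (A : Finset X) : (pseudoLoops T δ u A).Nonempty := by
  classical
  obtain ⟨L, hL⟩ := exists_isPseudoChain_length_le hT htrans hδ
  induction A using Finset.induction_on with
  | empty =>
    obtain ⟨l, hl, -, hchain⟩ := hL u u
    exact ⟨l, hl, hchain, by simp⟩
  | insert a A _ ih =>
    obtain ⟨l, hl, hchain, hA⟩ := ih
    obtain ⟨m, -, -, hm⟩ := hL u a
    obtain ⟨k, hk, -, hak⟩ := hL a u
    refine ⟨l ++ (m ++ k), by simp [hl], hchain.append (hm.append hak), fun b hb => ?_⟩
    rcases Finset.mem_insert.1 hb with rfl | hb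
    · have : b ∈ k := by cases hak <;> simp at hk ⊢
      simp [this]
    · simp [hA b hb]

variable {E : Type*} [NormedAddCommGroup E] [NormedSpace ℝ E] {φ : X → E}

theorem exists_mem_pseudoLoops_dist_birkhoffAverage_le (hT : Continuous T)
    (htrans : IsTransitiveMap T) (hδ : 0 < δ) (hφ : Continuous φ) (u : X) (A : Finset X) :
    ∃ C : ℝ, ∀ (x : X) (n : ℕ), n ≠ 0 → ∃ l ∈ pseudoLoops T δ u A,
      dist (birkhoffAverage ℝ T φ n x) (listMean φ l) ≤ C / n := by
  obtain ⟨B, hB⟩ := isCompact_univ.exists_bound_of_continuousOn hφ.continuousOn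
  replace hB (x : X) : ‖φ x‖ ≤ B := hB x (mem_univ x)
  have hB0 : 0 ≤ B := (norm_nonneg _).trans (hB u)
  obtain ⟨L, hL⟩ := exists_isPseudoChain_length_le hT htrans hδ
  obtain ⟨l, hl, hloop, hA⟩ := pseudoLoops_nonempty hT htrans hδ u A
  refine ⟨2 * B * (l.length + L + L), fun x n hn => ?_⟩
  obtain ⟨n, rfl⟩ := Nat.exists_eq_succ_of_ne_zero hn
  obtain ⟨m, -, hm, hux⟩ := hL u x
  obtain ⟨k, -, hk, hxu⟩ := hL (T^[n + 1] x) u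
  have horbit : IsPseudoChain T δ x (List.iterate T x (n + 1)) (T^[n + 1] x) :=
    .iterate_of_dist_lt (by simpa using hδ)
  refine ⟨l ++ (m ++ (List.iterate T x (n + 1) ++ k)), ⟨by simp [hl],
    hloop.append (hux.append (horbit.append hxu)), fun a ha => by simp [hA a ha]⟩, ?_⟩
  have reorder : (l ++ (m ++ (List.iterate T x (n + 1) ++ k))).Perm
      ((l ++ m ++ k) ++ List.iterate T x (n + 1)) := by
    simpa only [List.append_assoc] using (List.perm_append_comm
      (l₁ := List.iterate T x (n + 1)) (l₂ := k)).append_left (l ++ m)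
  rw [listMean_perm reorder, ← listMean_iterate]
  refine (dist_listMean_append_le hB hB0 _ (by simp)).trans ?_
  simp only [List.length_append, List.length_iterate, Nat.cast_add]
  gcongr

theorem integral_mem_closure_image_listMean_pseudoLoops [MeasurableSpace X] [OpensMeasurableSpace X]
    [CompleteSpace E] (hT : Continuous T)
    (htrans : IsTransitiveMap T) (hδ : 0 < δ) (hφ : Continuous φ) (u : X) (A : Finset X)
    {μ : Measure X} [IsProbabilityMeasure μ] (hμ : MeasurePreserving T μ μ) :
    ∫ x, φ x ∂μ ∈ closure (listMean φ '' pseudoLoops T δ u A) := by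
  obtain ⟨C, hC⟩ := exists_mem_pseudoLoops_dist_birkhoffAverage_le hT htrans hδ hφ u A
  have hconvex : Convex ℝ (closure (listMean φ '' pseudoLoops T δ u A)) :=
    convex_closure_image_listMean (fun h => h.1 rfl) fun _ hl _ hm => append_mem_pseudoLoops hl hm
  rw [← closure_closure, Metric.closure_eq_iInter_cthickening]
  refine mem_iInter₂.2 fun ε hε => ?_
  obtain ⟨n, hCn, hn⟩ := (((tendsto_const_div_atTop_nhds_zero_nat C).eventually_le_const hε).and
    (eventually_ne_atTop 0)).exists
  rw [← integral_birkhoffAverage hμ (integrable_of_continuous_of_compactSpace hφ) hn]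
  refine (hconvex.cthickening ε).integral_mem Metric.isClosed_cthickening
    (Eventually.of_forall fun x => ?_)
    (integrable_of_continuous_of_compactSpace (continuous_birkhoffAverage hT hφ n))
  obtain ⟨l, hl, hd⟩ := hC x n hn
  exact Metric.mem_cthickening_of_dist_le _ _ _ _ (subset_closure (mem_image_of_mem _ hl))
    (hd.trans hCn)

end TransitiveChains

theorem exists_periodic_isPseudoOrbit_average_near {X : Type*} [MetricSpace X] [CompactSpace X]
    [Nonempty X] [MeasurableSpace X] [OpensMeasurableSpace X] {T : X → X} {δ : ℝ}
    (hT : Continuous T) (htrans : IsTransitiveMap T) (hδ : 0 < δ) (F : Finset C(X, ℝ))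
    (A : Finset X) {μ : Measure X} [IsProbabilityMeasure μ] (hμ : MeasurePreserving T μ μ) {κ : ℝ}
    (hκ : 0 < κ) :
    ∃ (n : ℕ) (z : ℕ → X), n ≠ 0 ∧ Periodic z n ∧ IsPseudoOrbit T δ z ∧
      (∀ a ∈ A, ∃ i, z i = a) ∧
      ∀ f ∈ F, |(n : ℝ)⁻¹ * ∑ i ∈ Finset.range n, f (z i) - ∫ x, f x ∂μ| < κ := by
  obtain ⟨u⟩ := ‹Nonempty X›
  let φ : X → F → ℝ := fun x f => f.1 x
  have hφ : Continuous φ := continuous_pi fun f => f.1.continuous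
  obtain ⟨_, ⟨l, ⟨hl, hloop, hA⟩, rfl⟩, hdist⟩ := Metric.mem_closure_iff.1
    (integral_mem_closure_image_listMean_pseudoLoops hT htrans hδ hφ u A hμ) κ hκ
  obtain ⟨z, hz, hpseudo, hzl⟩ := exists_periodic_isPseudoOrbit hl hloop
  refine ⟨l.length, z, by simpa using hl, hz, hpseudo, fun a ha => ?_, fun f hf => ?_⟩
  · have ha := hA a ha
    rw [← hzl] at ha
    obtain ⟨i, -, hi⟩ := List.mem_map.1 ha
    exact ⟨i, hi⟩
  · have hf_dist := (dist_le_pi_dist _ _ (⟨f, hf⟩ : F)).trans_lt hdist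
    rw [eval_integral fun g => integrable_of_continuous_of_compactSpace g.1.continuous, dist_comm,
      Real.dist_eq, ← hzl, listMean_map_range] at hf_dist
    simpa [φ] using hf_dist

theorem sum_range_add_of_periodic {M : Type*} [AddCommMonoid M] {z : ℕ → M} {n : ℕ}
    (hz : Periodic z n) (r : ℕ) :
    ∑ i ∈ Finset.range n, z (r + i) = ∑ i ∈ Finset.range n, z i := by
  induction r with
  | zero => simp
  | succ r ih =>
    cases n with
    | zero => simp
    | succ n =>
      rw [← ih, Finset.sum_range_succ, Finset.sum_range_succ', add_right_comm r, add_assoc r, hz r]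
      simp only [add_zero, add_right_comm r 1, add_assoc r]

section TracingSet

variable {X : Type*} [PseudoMetricSpace X] {T : X → X} {z : ℕ → X} {n : ℕ} {η : ℝ}

/-- The points whose orbit under `T` stays `η`-close to some shift of the sequence `z`. All shifts
are allowed so that the set is forward invariant. -/
def tracingSet (T : X → X) (z : ℕ → X) (η : ℝ) : Set X :=
  {w | ∃ r, ∀ j, dist (T^[j] w) (z (r + j)) ≤ η}

theorem isClosed_tracingSet_of_periodic (hT : Continuous T) (hn : n ≠ 0) (hz : Periodic z n) :
    IsClosed (tracingSet T z η) := by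
  have eq_iUnion : tracingSet T z η =
      ⋃ r ∈ Finset.range n, ⋂ j, {w | dist (T^[j] w) (z (r + j)) ≤ η} := by
    ext w
    simp only [tracingSet, mem_ofPred_eq, mem_iUnion, mem_iInter, Finset.mem_range, exists_prop]
    refine ⟨fun ⟨r, hr⟩ => ⟨r % n, Nat.mod_lt _ (Nat.pos_of_ne_zero hn), fun j => ?_⟩,
      fun ⟨r, _, hr⟩ => ⟨r, hr⟩⟩
    rw [← hz.map_mod_nat, Nat.mod_add_mod, hz.map_mod_nat]
    exact hr j
  rw [eq_iUnion]
  exact isClosed_biUnion_finset fun r _ => isClosed_iInter fun j =>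
    isClosed_le ((hT.iterate j).dist continuous_const) continuous_const

theorem mapsTo_tracingSet : MapsTo T (tracingSet T z η) (tracingSet T z η) := by
  rintro w ⟨r, hr⟩
  refine ⟨r + 1, fun j => ?_⟩
  rw [← iterate_succ_apply, add_right_comm]
  exact hr (j + 1)

theorem exists_dist_iterate_le_of_mem_tracingSet (hn : n ≠ 0) (hz : Periodic z n) {w : X}
    (hw : w ∈ tracingSet T z η) (i : ℕ) : ∃ k, dist (T^[k] w) (z i) ≤ η := by
  obtain ⟨r, hr⟩ := hw
  have hrn : r ≤ r * n := Nat.le_mul_of_pos_right r (Nat.pos_of_ne_zero hn)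
  have shift : z (i + r * n) = z i := hz.nat_mul r i
  refine ⟨i + (r * n - r), ?_⟩
  rw [← shift, show i + r * n = r + (i + (r * n - r)) by omega]
  exact hr _

theorem abs_birkhoffAverage_sub_le_of_mem_tracingSet (hz : Periodic z n) {f : X → ℝ} {κ : ℝ}
    (hκ : 0 ≤ κ) (hf : ∀ x y, dist x y ≤ η → |f x - f y| ≤ κ) {w : X}
    (hw : w ∈ tracingSet T z η) :
    |birkhoffAverage ℝ T f n w - (n : ℝ)⁻¹ * ∑ i ∈ Finset.range n, f (z i)| ≤ κ := by
  obtain ⟨r, hr⟩ := hw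
  rw [← sum_range_add_of_periodic (z := fun i => f (z i)) (fun i => congrArg f (hz i)) r,
    birkhoffAverage, birkhoffSum, smul_eq_mul, ← mul_sub, ← Finset.sum_sub_distrib, abs_mul,
    abs_of_nonneg (by positivity)]
  refine inv_mul_le_of_le_mul₀ (Nat.cast_nonneg n) hκ ?_
  calc |∑ i ∈ Finset.range n, (f (T^[i] w) - f (z (r + i)))|
      ≤ ∑ i ∈ Finset.range n, |f (T^[i] w) - f (z (r + i))| := Finset.abs_sum_le_sum_abs _ _
    _ ≤ ∑ _i ∈ Finset.range n, κ := Finset.sum_le_sum fun i _ => hf _ _ (hr i)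
    _ = n * κ := by simp

end TracingSet

theorem card_mul_measure_singleton_le_measure_univ {X ι : Type*} [MeasurableSpace X]
    {T : X → X} {ν : Measure X} (hν : MeasurePreserving T ν ν) {s : Finset ι}
    {U : ι → Set X} (hU : ∀ i ∈ s, MeasurableSet (U i))
    (hdisj : (s : Set ι).PairwiseDisjoint U) {x : X} (hx : ∀ i ∈ s, ∃ k, T^[k] x ∈ U i) :
    s.card * ν {x} ≤ ν univ := by
  have measure_singleton_le : ∀ i ∈ s, ν {x} ≤ ν (U i) := fun i hi => by
    obtain ⟨k, hk⟩ := hx i hi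
    rw [← (hν.iterate k).measure_preimage (hU i hi).nullMeasurableSet]
    exact measure_mono (singleton_subset_iff.2 hk)
  calc s.card * ν {x} = ∑ _i ∈ s, ν {x} := by simp
    _ ≤ ∑ i ∈ s, ν (U i) := Finset.sum_le_sum measure_singleton_le
    _ = ν (⋃ i ∈ s, U i) := (measure_biUnion_finset hdisj hU).symm
    _ ≤ ν univ := measure_mono (subset_univ _)

theorem eventually_forall_abs_sub_le_of_dist_le {X : Type*} [PseudoMetricSpace X]
    [CompactSpace X] (F : Finset C(X, ℝ)) {κ : ℝ} (hκ : 0 < κ) :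
    ∀ᶠ η in 𝓝[>] (0 : ℝ), ∀ f ∈ F, ∀ x y, dist x y ≤ η → |f x - f y| ≤ κ := by
  refine (eventually_all_finset F).2 fun f _ => ?_
  obtain ⟨η₀, hη₀, hf⟩ := Metric.uniformContinuous_iff.1
    (CompactSpace.uniformContinuous_of_continuous f.continuous) κ hκ
  filter_upwards [Ioo_mem_nhdsGT hη₀] with η hη x y hxy
  exact (hf (hxy.trans_lt hη.2)).le

section Shadowing

variable {X : Type*} [MetricSpace X] [CompactSpace X] [MeasurableSpace X] [BorelSpace X] {T : X → X}

theorem exists_mem_invariantMeasures_ae_near [Nonempty X] (hT : Continuous T)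
    (htrans : IsTransitiveMap T) (hshadow : HasShadowing T) {μ : ProbabilityMeasure X}
    (hμ : μ ∈ invariantMeasures T) (F : Finset C(X, ℝ)) {κ : ℝ} (hκ : 0 < κ) {ι : Type*}
    (s : Finset ι) {U : ι → Set X} (hUo : ∀ i ∈ s, IsOpen (U i))
    (hUne : ∀ i ∈ s, (U i).Nonempty) :
    ∃ ν ∈ invariantMeasures T, ∃ n : ℕ, n ≠ 0 ∧ ∀ᵐ w ∂(ν : Measure X),
      (∀ i ∈ s, ∃ k, T^[k] w ∈ U i) ∧
      ∀ f ∈ F, |birkhoffAverage ℝ T f n w - ∫ x, f x ∂(μ : Measure X)| ≤ κ := by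
  classical
  choose! a ha using hUne
  have closedBall_subset : ∀ᶠ η in 𝓝[>] (0 : ℝ), ∀ i ∈ s, Metric.closedBall (a i) η ⊆ U i :=
    (eventually_all_finset s).2 fun i hi => nhdsWithin_le_nhds
      (eventually_closedBall_subset ((hUo i hi).mem_nhds (ha i hi)))
  obtain ⟨η, ⟨hF, hU⟩, hη⟩ := (((eventually_forall_abs_sub_le_of_dist_le F (half_pos hκ)).and
    closedBall_subset).and self_mem_nhdsWithin).exists
  obtain ⟨δ, hδ, htrace⟩ := hshadow η hη
  obtain ⟨n, z, hn, hz, hpseudo, hza, hzF⟩ := exists_periodic_isPseudoOrbit_average_near hT htrans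
    hδ F (s.image a) hμ (half_pos hκ)
  obtain ⟨y, hy⟩ := htrace z hpseudo
  obtain ⟨ν, hν, hνZ⟩ := exists_mem_invariantMeasures_of_isClosed hT
    (isClosed_tracingSet_of_periodic (η := η) hT hn hz)
    ⟨y, 0, fun j => by simpa using (hy j).le⟩ mapsTo_tracingSet
  refine ⟨ν, hν, n, hn, hνZ.mono fun w hw => ⟨fun i hi => ?_, fun f hf => ?_⟩⟩
  · obtain ⟨j, hj⟩ := hza (a i) (Finset.mem_image_of_mem a hi)
    obtain ⟨k, hk⟩ := exists_dist_iterate_le_of_mem_tracingSet hn hz hw j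
    exact ⟨k, hU i hi (Metric.mem_closedBall.2 (hj ▸ hk))⟩
  · have near_z := abs_birkhoffAverage_sub_le_of_mem_tracingSet hz (half_pos hκ).le (hF f hf) hw
    linarith [hzF f hf, abs_sub_le (birkhoffAverage ℝ T f n w)
      ((n : ℝ)⁻¹ * ∑ i ∈ Finset.range n, f (z i)) (∫ x, f x ∂(μ : Measure X))]

theorem exists_mem_invariantMeasures_integral_near [Nonempty X] (hT : Continuous T)
    (htrans : IsTransitiveMap T) (hshadow : HasShadowing T) {μ : ProbabilityMeasure X}
    (hμ : μ ∈ invariantMeasures T) (F : Finset C(X, ℝ)) {κ : ℝ} (hκ : 0 < κ) {ι : Type*}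
    (s : Finset ι) {U : ι → Set X} (hUo : ∀ i ∈ s, IsOpen (U i))
    (hUne : ∀ i ∈ s, (U i).Nonempty) :
    ∃ ν ∈ invariantMeasures T, (∀ᵐ w ∂(ν : Measure X), ∀ i ∈ s, ∃ k, T^[k] w ∈ U i) ∧
      (∃ n : ℕ, n ≠ 0 ∧ ∀ f ∈ F, ∫ x, |birkhoffAverage ℝ T f n x - ∫ y, f y ∂(μ : Measure X)|
        ∂(ν : Measure X) ≤ κ) ∧
      ∀ f ∈ F, |∫ x, f x ∂(ν : Measure X) - ∫ x, f x ∂(μ : Measure X)| ≤ κ := by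
  obtain ⟨ν, hν, n, hn, hae⟩ :=
    exists_mem_invariantMeasures_ae_near hT htrans hshadow hμ F hκ s hUo hUne
  have integral_le : ∀ f ∈ F, ∫ x, |birkhoffAverage ℝ T f n x - ∫ y, f y ∂(μ : Measure X)|
      ∂(ν : Measure X) ≤ κ := fun f hf => by
    have bound := integral_mono_of_nonneg (g := fun _ => κ)
      (Eventually.of_forall fun _ => abs_nonneg _) (integrable_const κ)
      (hae.mono fun w hw => hw.2 f hf)
    simpa using bound
  refine ⟨ν, hν, hae.mono fun w hw => hw.1, ⟨n, hn, integral_le⟩, fun f hf => ?_⟩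
  have near := norm_integral_sub_measureReal_univ_smul_le hν
    (integrable_of_continuous_of_compactSpace f.continuous) hn (∫ y, f y ∂(μ : Measure X))
  rw [probReal_univ, one_smul] at near
  exact near.trans (integral_le f hf)

theorem residual_setOf_forall_measure_singleton_lt [Infinite X] (hT : Continuous T)
    (htrans : IsTransitiveMap T) (hshadow : HasShadowing T) {ε : ℝ≥0∞} (hε : ε ≠ 0) :
    {μ : invariantMeasures T | ∀ x, ((μ : ProbabilityMeasure X) : Measure X) {x} < ε} ∈
      residual (invariantMeasures T) := by
  refine residual_of_dense_open
    ((isOpen_setOf_forall_measure_singleton_lt ε).preimage continuous_subtype_val)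
    (dense_of_forall_finset_exists_integral_near
      (P := fun ν : ProbabilityMeasure X => ∀ x, (ν : Measure X) {x} < ε) fun μ hμ F κ hκ => ?_)
  obtain ⟨m, hm⟩ := ENNReal.exists_inv_nat_lt hε
  obtain ⟨U, hUinf, hUo, hdisj⟩ := exists_seq_infinite_isOpen_pairwise_disjoint X
  obtain ⟨ν, hν, visits, -, near⟩ := exists_mem_invariantMeasures_integral_near hT htrans hshadow
    hμ F hκ (Finset.range m) (fun i _ => hUo i) fun i _ => (hUinf i).nonempty
  refine ⟨ν, hν, fun x => ?_, near⟩
  rcases eq_or_ne ((ν : Measure X) {x}) 0 with hx | hx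
  · exact hx.trans_lt hε.bot_lt
  · obtain ⟨_, rfl, visits_x⟩ := ((frequently_ae_mem_iff.2 hx).and_eventually visits).exists
    have card_mul_le := card_mul_measure_singleton_le_measure_univ hν (s := Finset.range m)
      (fun i _ => (hUo i).measurableSet) (hdisj.set_pairwise _) visits_x
    rw [Finset.card_range, measure_univ, mul_comm, ← ENNReal.le_inv_iff_mul_le] at card_mul_le
    exact card_mul_le.trans_lt hm

theorem residual_setOf_forall_measure_singleton_eq_zero [Infinite X] (hT : Continuous T)
    (htrans : IsTransitiveMap T) (hshadow : HasShadowing T) :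
    {μ : invariantMeasures T | ∀ x, ((μ : ProbabilityMeasure X) : Measure X) {x} = 0} ∈
      residual (invariantMeasures T) := by
  filter_upwards [eventually_countable_forall.2 fun k : ℕ =>
    residual_setOf_forall_measure_singleton_lt hT htrans hshadow
      (ε := (k : ℝ≥0∞)⁻¹) (by simp)] with μ hμ x
  by_contra hx
  obtain ⟨k, hk⟩ := ENNReal.exists_inv_nat_lt hx
  exact (hμ k x).not_gt hk

theorem residual_setOf_exists_integral_abs_birkhoffAverage_sub_lt [Nonempty X] (hT : Continuous T)
    (htrans : IsTransitiveMap T) (hshadow : HasShadowing T) (f : C(X, ℝ)) {ε : ℝ} (hε : 0 < ε) :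
    {μ : invariantMeasures T | ∃ n : ℕ, n ≠ 0 ∧ ∃ c : ℝ,
      ∫ x, |birkhoffAverage ℝ T f n x - c| ∂((μ : ProbabilityMeasure X) : Measure X) < ε} ∈
      residual (invariantMeasures T) := by
  classical
  refine residual_of_dense_open ((isOpen_setOf_exists_integral_abs_birkhoffAverage_sub_lt
      hT f ε).preimage continuous_subtype_val)
    (dense_of_forall_finset_exists_integral_near (P := fun ν : ProbabilityMeasure X => ∃ n : ℕ,
      n ≠ 0 ∧ ∃ c : ℝ, ∫ x, |birkhoffAverage ℝ T f n x - c| ∂(ν : Measure X) < ε)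
      fun μ hμ F κ hκ => ?_)
  obtain ⟨ν, hν, -, ⟨n, hn, average_near⟩, near⟩ := exists_mem_invariantMeasures_integral_near hT
    htrans hshadow hμ (insert f F) (lt_min hκ (half_pos hε)) (∅ : Finset ℕ) (U := fun _ => ∅)
    (by simp) (by simp)
  refine ⟨ν, hν, ⟨n, hn, ∫ x, f x ∂(μ : Measure X), ?_⟩, fun g hg => ?_⟩
  · exact ((average_near f (Finset.mem_insert_self f F)).trans (min_le_right _ _)).trans_lt
      (half_lt_self hε)
  · exact (near g (Finset.mem_insert_of_mem hg)).trans (min_le_left _ _)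

theorem residual_setOf_ergodic [Nonempty X] (hT : Continuous T) (htrans : IsTransitiveMap T)
    (hshadow : HasShadowing T) :
    {μ : invariantMeasures T | Ergodic T ((μ : ProbabilityMeasure X) : Measure X)} ∈
      residual (invariantMeasures T) := by
  obtain ⟨D, hDc, hDd⟩ := TopologicalSpace.exists_countable_dense C(X, ℝ)
  filter_upwards [(eventually_countable_ball hDc).2 fun f _ => eventually_countable_forall.2
    fun k : ℕ => residual_setOf_exists_integral_abs_birkhoffAverage_sub_lt hT htrans hshadow f
      (ε := 1 / ((k : ℝ) + 1)) (by positivity)] with μ hμ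
  refine ergodic_of_dense_of_forall_birkhoffAverage μ.2 hDd fun f hf ε hε => ?_
  obtain ⟨k, hk⟩ := exists_nat_one_div_lt hε
  obtain ⟨n, hn, c, hc⟩ := hμ f hf k
  exact ⟨n, hn, c, hc.trans hk⟩

end Shadowing

theorem mainTheorem7 {X : Type*} [MetricSpace X] [CompactSpace X] [Infinite X]
    [MeasurableSpace X] [BorelSpace X] (T : X → X) (hT : Continuous T)
    (htrans : IsTransitiveMap T) (hshadow : HasShadowing T) :
    {μ : invariantMeasures T |
        (∀ x : X, ((μ : ProbabilityMeasure X) : Measure X) {x} = 0) ∧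
          Ergodic T ((μ : ProbabilityMeasure X) : Measure X)} ∈
      residual (invariantMeasures T) := by
  filter_upwards [residual_setOf_forall_measure_singleton_eq_zero hT htrans hshadow,
    residual_setOf_ergodic hT htrans hshadow] with μ nonatomic ergodic
  exact ⟨nonatomic, ergodic⟩
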